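/- Let $L$ be a frame. Write $BL$ for the lattice of complemented elements of $L$; $L$ is zero-dimensional if every $a\in L$ is the join of the complemented elements below it, and $\beta_0L$ is the frame of all ideals of the lattice $BL$, ordered by inclusion. Let $\mathcal{R}L$ be the commutative ring of frame homomorphisms $\alpha:\mathcal{L}(\mathbb{R})\to L$, where $\mathcal{L}(\mathbb{R})\cong\mathfrak{O}\mathbb{R}$ is the frame of reals, with the operations $(\alpha\diamond\beta)(U)=\bigvee\{\alpha(V)\wedge\beta(W) : V\diamond W\subseteq U\}$ for $\diamond\in\{+,\cdot\}$ (with $U,V,W\subseteq\mathbb{R}$ open and $V\diamond W=\{v\diamond w: v\in V, w\in W\}$) and with the constants $\mathbf{r}(U)=1$ if $r\in U$ and $\mathbf{r}(U)=0$ if $r\notin U$ ($r\in\mathbb{R}$). Put $\operatorname{coz}\varphi=\varphi(-\infty,0)\vee\varphi(0,\infty)$, $R_\alpha=\{r\in\mathbb{R} : \operatorname{coz}(\alpha-\mathbf{r})\neq 1\}$, and $\mathcal{R}_cL=\{\alpha\in\mathcal{R}L : R_\alpha\text{ is countable}\}$. For a commutative ring $A$ with identity let $\mathfrak{O}(\operatorname{Max}A)$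 be the frame of open sets of the set of maximal ideals of $A$ with the hull-kernel topology. Let $L$ be a zero-dimensional frame. Then $\mathcal{R}_c(\beta_0L)$ is a subring of $\mathcal{R}(\beta_0L)$ and there are frame isomorphisms $$\beta_0L\;\cong\;\mathfrak{O}(\operatorname{Max}(\mathcal{R}_c(\beta_0L)))\;\cong\;\mathfrak{O}(\operatorname{Max}(\mathcal{R}(\beta_0L))),$$ and, whenever $\mathcal{R}_cL$ is a subring of $\mathcal{R}L$, also $\beta_0L\cong\mathfrak{O}(\operatorname{Max}(\mathcal{R}_cL))$. -/

import Mathlib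

open TopologicalSpace

namespace PointfreeReal

universe u

/-! ## Two frame homomorphisms out of open-set frames, paired -/

section Pairing

variable {X Y Z : Type} [TopologicalSpace X] [TopologicalSpace Y] [TopologicalSpace Z]
variable {L : Type u} [Order.Frame L]

/-- The value at an open set `G` of `X × Y` of the homomorphism induced by `α` and `β`:
the join of all `α V ⊓ β W` over the open rectangles `V × W` inside `G`. -/
def pairFun (α : FrameHom (Opens X) L) (β : FrameHom (Opens Y) L) (G : Opens (X × Y)) : L :=
  ⨆ (V : Opens X) (W : Opens Y) (_ : (V : Set X) ×ˢ (W : Set Y) ⊆ G), α V ⊓ β W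

theorem le_pairFun (α : FrameHom (Opens X) L) (β : FrameHom (Opens Y) L) {G : Opens (X × Y)}
    {V : Opens X} {W : Opens Y} (h : (V : Set X) ×ˢ (W : Set Y) ⊆ G) : α V ⊓ β W ≤ pairFun α β G :=
  le_iSup_of_le V <| le_iSup_of_le W <| le_iSup_of_le h le_rfl

theorem pairFun_le (α : FrameHom (Opens X) L) (β : FrameHom (Opens Y) L) {G : Opens (X × Y)}
    {c : L} (h : ∀ (V : Opens X) (W : Opens Y),
      (V : Set X) ×ˢ (W : Set Y) ⊆ G → α V ⊓ β W ≤ c) :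
    pairFun α β G ≤ c :=
  iSup_le fun V => iSup_le fun W => iSup_le fun hVW => h V W hVW

theorem pairFun_mono (α : FrameHom (Opens X) L) (β : FrameHom (Opens Y) L)
    {G H : Opens (X × Y)} (h : G ≤ H) : pairFun α β G ≤ pairFun α β H :=
  pairFun_le α β fun _ _ hVW => le_pairFun α β (hVW.trans h)

theorem pairFun_sSup_le [LocallyCompactSpace Y] (α : FrameHom (Opens X) L)
    (β : FrameHom (Opens Y) L) (S : Set (Opens (X × Y))) {c : L}
    (hc : ∀ G ∈ S, pairFun α β G ≤ c) : pairFun α β (sSup S) ≤ c := by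
  classical
  refine pairFun_le α β fun V W hVW => ?_
  -- exhaust `W` by open sets with compact hull inside `W`
  have hW : W ≤ sSup {W' : Opens Y | ∃ K : Set Y, IsCompact K ∧ (W' : Set Y) ⊆ K ∧ K ⊆ W} := by
    intro y hy
    obtain ⟨K, hK, hyK, hKW⟩ := exists_compact_subset W.isOpen hy
    rw [Opens.mem_sSup]
    exact ⟨⟨interior K, isOpen_interior⟩, ⟨K, hK, interior_subset, hKW⟩, hyK⟩
  refine (inf_le_inf_left _ (OrderHomClass.mono β hW)).trans ?_
  rw [map_sSup, inf_sSup_eq]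
  refine iSup₂_le ?_
  rintro _ ⟨W', ⟨K, hK, hWK, hKW⟩, rfl⟩
  -- exhaust `V` by open sets over which finitely many rectangles cover the hull
  have hV : V ≤ sSup {U : Opens X | α U ⊓ β W' ≤ c} := by
    intro x hx
    rw [Opens.mem_sSup]
    have hloc : ∀ y : K, ∃ (A : Opens X) (B : Opens Y), x ∈ A ∧ (y : Y) ∈ B ∧ α A ⊓ β B ≤ c := by
      intro y
      have hxy : (x, (y : Y)) ∈ sSup S := hVW ⟨hx, hKW y.2⟩
      obtain ⟨G, hG, hxyG⟩ := Opens.mem_sSup.1 hxy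
      obtain ⟨A, B, hA, hB, hxA, hyB, hAB⟩ := isOpen_prod_iff.1 G.isOpen x y hxyG
      exact ⟨⟨A, hA⟩, ⟨B, hB⟩, hxA, hyB,
        (le_pairFun α β (V := ⟨A, hA⟩) (W := ⟨B, hB⟩) hAB).trans (hc G hG)⟩
    choose A B hxA hyB hAB using hloc
    obtain ⟨t, ht⟩ := hK.elim_finite_subcover (fun y : K => (B y : Set Y))
      (fun y => (B y).isOpen) fun y hy => Set.mem_iUnion.2 ⟨⟨y, hy⟩, hyB ⟨y, hy⟩⟩
    refine ⟨t.inf A, ?_, ?_⟩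
    · have hW' : W' ≤ t.sup B := by
        intro y hy
        obtain ⟨i, hi, hyi⟩ := Set.mem_iUnion₂.1 (ht (hWK hy))
        exact (Finset.le_sup (f := B) hi : B i ≤ t.sup B) hyi
      change α (t.inf A) ⊓ β W' ≤ c
      refine (inf_le_inf_left _ (OrderHomClass.mono β hW')).trans ?_
      rw [map_finset_sup, Finset.sup_inf_distrib_left]
      refine Finset.sup_le fun i hi => ?_
      exact (inf_le_inf_right _ (OrderHomClass.mono α (Finset.inf_le hi))).trans (hAB i)
    · have : ∀ s : Finset K, x ∈ s.inf A := by
        intro s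
        induction s using Finset.induction_on with
        | empty => exact Set.mem_univ x
        | insert a s _ ih => rw [Finset.inf_insert]; exact ⟨hxA a, ih⟩
      exact this t
  refine (inf_le_inf_right _ (OrderHomClass.mono α hV)).trans ?_
  rw [map_sSup, sSup_inf_eq]
  refine iSup₂_le ?_
  rintro _ ⟨U, hU, rfl⟩
  exact hU

/-- The frame homomorphism out of the open sets of `X × Y` induced by two frame homomorphisms
out of the open sets of `X` and of `Y`. -/
def pair [LocallyCompactSpace Y] (α : FrameHom (Opens X) L) (β : FrameHom (Opens Y) L) :
    FrameHom (Opens (X × Y)) L where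
  toFun := pairFun α β
  map_top' := top_le_iff.1 <| by
    simpa using le_pairFun α β (G := ⊤) (V := ⊤) (W := ⊤) le_top
  map_inf' G H := by
    refine le_antisymm (le_inf (pairFun_mono α β inf_le_left) (pairFun_mono α β inf_le_right)) ?_
    simp only [pairFun, iSup_inf_eq, inf_iSup_eq]
    refine iSup_le fun V => iSup_le fun W => iSup_le fun hVW => iSup_le fun V' =>
      iSup_le fun W' => iSup_le fun hVW' => ?_
    rw [inf_inf_inf_comm, ← map_inf, ← map_inf]
    refine le_pairFun α β ?_
    rintro ⟨x, y⟩ ⟨hx, hy⟩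
    exact ⟨hVW' ⟨hx.1, hy.1⟩, hVW ⟨hx.2, hy.2⟩⟩
  map_sSup' S := by
    refine le_antisymm (pairFun_sSup_le α β S fun G hG => le_sSup ⟨G, hG, rfl⟩) ?_
    refine sSup_le ?_
    rintro _ ⟨G, hG, rfl⟩
    exact pairFun_mono α β (le_sSup hG)

theorem pair_apply [LocallyCompactSpace Y] (α : FrameHom (Opens X) L) (β : FrameHom (Opens Y) L)
    (G : Opens (X × Y)) :
    pair α β G = ⨆ (V : Opens X) (W : Opens Y) (_ : (V : Set X) ×ˢ (W : Set Y) ⊆ G), α V ⊓ β W :=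
  rfl

theorem pair_comap_fst [LocallyCompactSpace Y] (α : FrameHom (Opens X) L)
    (β : FrameHom (Opens Y) L) : (pair α β).comp (Opens.comap ContinuousMap.fst) = α := by
  ext U
  refine le_antisymm (pairFun_le α β fun V W h => ?_) ?_
  · by_cases hW : W = ⊥
    · simp [hW]
    · obtain ⟨y, hy⟩ : ∃ y, y ∈ W := by
        by_contra hne
        push Not at hne
        exact hW (Opens.ext (Set.eq_empty_of_forall_notMem hne))
      exact inf_le_left.trans (OrderHomClass.mono α fun x hx => h (⟨hx, hy⟩ : (x, y) ∈ (V : Set X) ×ˢ (W : Set Y)))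
  · have := le_pairFun α β (G := Opens.comap ContinuousMap.fst U) (V := U) (W := ⊤)
      fun p hp => hp.1
    rw [map_top] at this
    exact (inf_top_eq (α U)).ge.trans this

theorem pair_comap_snd [LocallyCompactSpace Y] (α : FrameHom (Opens X) L)
    (β : FrameHom (Opens Y) L) : (pair α β).comp (Opens.comap ContinuousMap.snd) = β := by
  ext U
  refine le_antisymm (pairFun_le α β fun V W h => ?_) ?_
  · by_cases hV : V = ⊥
    · simp [hV]
    · obtain ⟨x, hx⟩ : ∃ x, x ∈ V := by
        by_contra hne
        push Not at hne
        exact hV (Opens.ext (Set.eq_empty_of_forall_notMem hne))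
      exact inf_le_right.trans (OrderHomClass.mono β fun y hy => h (⟨hx, hy⟩ : (x, y) ∈ (V : Set X) ×ˢ (W : Set Y)))
  · have := le_pairFun α β (G := Opens.comap ContinuousMap.snd U) (V := ⊤) (W := U)
      fun p hp => hp.2
    rw [map_top] at this
    exact (top_inf_eq (β U)).ge.trans this

theorem pair_comap [LocallyCompactSpace Y] (η : FrameHom (Opens Z) L) (f : C(Z, X))
    (g : C(Z, Y)) :
    pair (η.comp (Opens.comap f)) (η.comp (Opens.comap g)) =
      η.comp (Opens.comap (f.prodMk g)) := by
  ext G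
  refine le_antisymm (pairFun_le _ _ fun V W h => ?_) ?_
  · simp only [FrameHom.comp_apply]
    rw [← map_inf]
    exact OrderHomClass.mono η fun z hz => h (⟨hz.1, hz.2⟩ : (f z, g z) ∈ (V : Set X) ×ˢ (W : Set Y))
  · have hG : Opens.comap (f.prodMk g) G ≤
        sSup {T | ∃ (V : Opens X) (W : Opens Y), (V : Set X) ×ˢ (W : Set Y) ⊆ G ∧
          T = Opens.comap f V ⊓ Opens.comap g W} := by
      intro z hz
      obtain ⟨A, B, hA, hB, hzA, hzB, hAB⟩ := isOpen_prod_iff.1 G.isOpen (f z) (g z) hz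
      rw [Opens.mem_sSup]
      exact ⟨_, ⟨⟨A, hA⟩, ⟨B, hB⟩, hAB, rfl⟩, hzA, hzB⟩
    refine (OrderHomClass.mono η hG).trans ?_
    rw [map_sSup]
    refine sSup_le ?_
    rintro _ ⟨_, ⟨V, W, hVW, rfl⟩, rfl⟩
    rw [map_inf]
    exact le_pairFun (η.comp (Opens.comap f)) (η.comp (Opens.comap g)) hVW

end Pairing

/-! ## The ring of continuous real-valued functions on a frame -/

/-- `R L`: frame homomorphisms from the frame of reals (the open sets of `ℝ`) to `L`. -/
def R (L : Type u) [Order.Frame L] : Type u := FrameHom (Opens ℝ) L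

namespace R

variable {L : Type u} [Order.Frame L]

instance : FunLike (R L) (Opens ℝ) L := inferInstanceAs (FunLike (FrameHom (Opens ℝ) L) _ _)

instance : FrameHomClass (R L) (Opens ℝ) L :=
  inferInstanceAs (FrameHomClass (FrameHom (Opens ℝ) L) _ _)

/-- The constant function with value `r`: it sends `U` to `⊤` if `r ∈ U`, and to `⊥` otherwise. -/
def const (r : ℝ) : R L :=
  { toFun := fun U => ⨆ _ : r ∈ U, (⊤ : L)
    map_top' := by simp
    map_inf' := fun U V => by
      change (⨆ _ : r ∈ U ∧ r ∈ V, (⊤ : L)) = _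
      rw [iSup_and, iSup_inf_eq]
      simp
    map_sSup' := fun S => by
      rw [sSup_image]
      simp only [Opens.mem_sSup, iSup_exists, iSup_and] : FrameHom (Opens ℝ) L }

/-- Composition with a continuous operation in one variable: `U ↦ α (f⁻¹ U)`. -/
def op₁ (f : C(ℝ, ℝ)) (α : R L) : R L := FrameHom.comp α (Opens.comap f)

/-- The pointwise continuous operation in two variables:
`U ↦ ⨆ {α V ⊓ β W | V × W ⊆ f⁻¹ U}`. -/
def op₂ (f : C(ℝ × ℝ, ℝ)) (α β : R L) : R L := FrameHom.comp (pair α β) (Opens.comap f)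

theorem op₂_apply (f : C(ℝ × ℝ, ℝ)) (α β : R L) (U : Opens ℝ) :
    op₂ f α β U =
      ⨆ (V : Opens ℝ) (W : Opens ℝ) (_ : (V : Set ℝ) ×ˢ (W : Set ℝ) ⊆ f ⁻¹' U), α V ⊓ β W :=
  rfl

instance : Zero (R L) := ⟨const 0⟩
instance : One (R L) := ⟨const 1⟩
instance : Neg (R L) := ⟨op₁ ⟨fun x => -x, continuous_neg⟩⟩
instance : Add (R L) := ⟨op₂ ⟨fun p => p.1 + p.2, continuous_add⟩⟩
instance : Mul (R L) := ⟨op₂ ⟨fun p => p.1 * p.2, continuous_mul⟩⟩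

/-- A frame homomorphism out of the open sets of a space `Z` turns continuous functions on `Z`
into elements of `R L`. -/
def lift {Z : Type} [TopologicalSpace Z] (η : FrameHom (Opens Z) L) (f : C(Z, ℝ)) : R L :=
  η.comp (Opens.comap f)

section Lift

variable {Z : Type} [TopologicalSpace Z] (η : FrameHom (Opens Z) L)

theorem lift_const (r : ℝ) : lift η (ContinuousMap.const Z r) = const r := by
  refine DFunLike.ext (F := FrameHom (Opens ℝ) L) _ _ fun U => ?_
  change η (Opens.comap (ContinuousMap.const Z r) U) = ⨆ _ : r ∈ U, (⊤ : L)
  by_cases hr : r ∈ U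
  · have : Opens.comap (ContinuousMap.const Z r) U = ⊤ := by ext z; simp [hr]
    simp [this, hr]
  · have : Opens.comap (ContinuousMap.const Z r) U = ⊥ := by ext z; simp [hr]
    simp [this, hr]

theorem lift_zero : lift η 0 = 0 := lift_const η 0
theorem lift_one : lift η 1 = 1 := lift_const η 1
theorem lift_neg (f : C(Z, ℝ)) : lift η (-f) = -lift η f := rfl

theorem lift_add (f g : C(Z, ℝ)) : lift η (f + g) = lift η f + lift η g := by
  change _ = FrameHom.comp (pair (η.comp (Opens.comap f)) (η.comp (Opens.comap g))) _
  rw [pair_comap]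
  rfl

theorem lift_mul (f g : C(Z, ℝ)) : lift η (f * g) = lift η f * lift η g := by
  change _ = FrameHom.comp (pair (η.comp (Opens.comap f)) (η.comp (Opens.comap g))) _
  rw [pair_comap]
  rfl

end Lift

/-- Any three elements of `R L` come from continuous functions on one space. -/
theorem exists_lift (α β γ : R L) :
    ∃ (η : FrameHom (Opens (ℝ × ℝ × ℝ)) L) (f g h : C(ℝ × ℝ × ℝ, ℝ)),
      lift η f = α ∧ lift η g = β ∧ lift η h = γ := by
  have key : ∀ α β γ : FrameHom (Opens ℝ) L,
      (pair α (pair β γ)).comp (Opens.comap ContinuousMap.fst) = α ∧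
      ((pair α (pair β γ)).comp (Opens.comap ContinuousMap.snd)).comp
        (Opens.comap ContinuousMap.fst) = β ∧
      ((pair α (pair β γ)).comp (Opens.comap ContinuousMap.snd)).comp
        (Opens.comap ContinuousMap.snd) = γ := fun α β γ => by
    rw [pair_comap_snd]
    exact ⟨pair_comap_fst _ _, pair_comap_fst _ _, pair_comap_snd _ _⟩
  exact ⟨_, ContinuousMap.fst, ContinuousMap.fst.comp ContinuousMap.snd,
    ContinuousMap.snd.comp ContinuousMap.snd, key α β γ⟩

instance : CommRing (R L) where
  add_assoc α β γ := by
    obtain ⟨η, f, g, h, rfl, rfl, rfl⟩ := exists_lift α β γ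
    simp only [← lift_add, add_assoc]
  zero_add α := by
    obtain ⟨η, f, _, _, rfl, _, _⟩ := exists_lift α α α
    rw [← lift_zero η, ← lift_add, zero_add]
  add_zero α := by
    obtain ⟨η, f, _, _, rfl, _, _⟩ := exists_lift α α α
    rw [← lift_zero η, ← lift_add, add_zero]
  add_comm α β := by
    obtain ⟨η, f, g, _, rfl, rfl, _⟩ := exists_lift α β β
    rw [← lift_add, ← lift_add, add_comm]
  neg_add_cancel α := by
    obtain ⟨η, f, _, _, rfl, _, _⟩ := exists_lift α α α
    rw [← lift_neg, ← lift_add, neg_add_cancel, lift_zero]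
  mul_assoc α β γ := by
    obtain ⟨η, f, g, h, rfl, rfl, rfl⟩ := exists_lift α β γ
    simp only [← lift_mul, mul_assoc]
  one_mul α := by
    obtain ⟨η, f, _, _, rfl, _, _⟩ := exists_lift α α α
    rw [← lift_one η, ← lift_mul, one_mul]
  mul_one α := by
    obtain ⟨η, f, _, _, rfl, _, _⟩ := exists_lift α α α
    rw [← lift_one η, ← lift_mul, mul_one]
  mul_comm α β := by
    obtain ⟨η, f, g, _, rfl, rfl, _⟩ := exists_lift α β β
    rw [← lift_mul, ← lift_mul, mul_comm]
  zero_mul α := by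
    obtain ⟨η, f, _, _, rfl, _, _⟩ := exists_lift α α α
    rw [← lift_zero η, ← lift_mul, zero_mul]
  mul_zero α := by
    obtain ⟨η, f, _, _, rfl, _, _⟩ := exists_lift α α α
    rw [← lift_zero η, ← lift_mul, mul_zero]
  left_distrib α β γ := by
    obtain ⟨η, f, g, h, rfl, rfl, rfl⟩ := exists_lift α β γ
    simp only [← lift_mul, ← lift_add, mul_add]
  right_distrib α β γ := by
    obtain ⟨η, f, g, h, rfl, rfl, rfl⟩ := exists_lift α β γ
    simp only [← lift_mul, ← lift_add, add_mul]
  nsmul := nsmulRec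
  zsmul := zsmulRec

/-- The cozero element `φ(-,0) ∨ φ(0,-)`. -/
def coz (φ : R L) : L := φ ⟨Set.Iio 0, isOpen_Iio⟩ ⊔ φ ⟨Set.Ioi 0, isOpen_Ioi⟩

/-- The pointfree image `R_α = {r | coz (α - r) ≠ 1}`. -/
def pointfreeImage (α : R L) : Set ℝ := {r | coz (α - const r) ≠ ⊤}

/-- A subring `S` of `R L` is `R_c L` if its elements are exactly those with countable
pointfree image. (There is at most one such `S`; in some pointless frames these elements are not
closed under addition, and then there is none.) -/
def IsRc (S : Subring (R L)) : Prop := ∀ α : R L, α ∈ S ↔ (pointfreeImage α).Countable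

end R

/-! ## Zero-dimensional frames and the Banaschewski compactification -/

/-- Every element is the join of the complemented elements below it. (In a frame, `a` has a
complement if and only if its pseudocomplement is one, that is, `a ⊔ aᶜ = ⊤`.) -/
def IsZeroDimensional (L : Type u) [Order.Frame L] : Prop :=
  ∀ a : L, a = sSup {x : L | IsComplemented x ∧ x ≤ a}

/-- The ideals of a bounded-below distributive lattice form a frame under inclusion. -/
instance instFrameIdeal {P : Type u} [DistribLattice P] [OrderBot P] :
    Order.Frame (Order.Ideal P) :=
  .ofMinimalAxioms
    { inf_sSup_le_iSup_inf := fun I S => by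
        set J : Order.Ideal P := ⨆ K ∈ S, I ⊓ K with hJ
        have hle : ∀ K ∈ S, I ⊓ K ≤ J := fun K hK => le_iSup₂_of_le K hK le_rfl
        let T : Order.Ideal P :=
          { carrier := {x | ∀ i ∈ I, i ⊓ x ∈ J}
            lower' := fun x y hyx hx i hi => J.lower (inf_le_inf_left i hyx) (hx i hi)
            nonempty' := ⟨⊥, fun i _ => by rw [inf_bot_eq]; exact J.bot_mem⟩
            directed' := fun x hx y hy => ⟨x ⊔ y, fun i hi => by
              rw [inf_sup_left]
              exact Order.Ideal.sup_mem (hx i hi) (hy i hi), le_sup_left, le_sup_right⟩ }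
        have hT : sSup S ≤ T := sSup_le fun K hK x hx i hi =>
          hle K hK ⟨I.lower inf_le_left hi, K.lower inf_le_right hx⟩
        intro x hx
        have := hT hx.2 x hx.1
        rwa [inf_idem] at this }

/-- `β₀ L`: the frame of ideals of the lattice of complemented elements of `L`. -/
abbrev BetaZero (L : Type u) [Order.Frame L] : Type u := Order.Ideal (Complementeds L)

end PointfreeReal

/-! In a ring `A`, let a Boolean lattice `P` index idempotents `e p`, with meets going to products
and complements to complementary idempotents. An ideal `I` of `P` gives the open set of those
maximal ideals that miss some `e p`, `p ∈ I`. This is an order embedding when only `⊥` is sent to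
`0`, and it is onto when `A` is an exchange ring in the following form: for each `a` there are
complementary `p`, `q` with `a ∣ e p` and `1 - a ∣ e q`.

For rings of real functions the idempotents are characteristic functions. If `p` lies below `{α >
1/3}` and its complement `q` below `{α < 2/3}`, then `α` is invertible on `p` and `1 - α` on `q`;
the inverses are cut off to `1 / max x (1/3)`, so that they are defined everywhere (`char_eq_mul`).
Everything thus reduces to separation. With a countable image, a cut at some `r` between `1/3` and
`2/3` outside the image does it; in a frame of ideals, compactness of the top element does it for
every `α`.

That the elements with countable image form a subring for a frame of ideals rests on prime ideals
serving as points: the pointfree image is the set of values at prime ideals, so images of sums and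
products are controlled pointwise. -/

namespace PointfreeReal

/-! ### Maximal spectra of rings with enough idempotents. -/

section Exchange

variable {A P : Type*} [CommRing A] [DistribLattice P] [BoundedOrder P] {e : P → A}

/-- The maximal ideals that miss one of the idempotents `e p`, `p ∈ I`. -/
def opensOfIdeal (e : P → A) (I : Order.Ideal P) : Opens (MaximalSpectrum A) where
  carrier := {m | ∃ p ∈ I, e p ∉ m.asIdeal}
  is_open' := by
    have : {m : MaximalSpectrum A | ∃ p ∈ I, e p ∉ m.asIdeal} =
        ⋃ p ∈ I, MaximalSpectrum.toPrimeSpectrum ⁻¹' (PrimeSpectrum.basicOpen (e p) : Set _) := by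
      ext m; simp [MaximalSpectrum.toPrimeSpectrum]
    rw [this]
    exact isOpen_biUnion fun p _ =>
      (PrimeSpectrum.basicOpen (e p)).isOpen.preimage MaximalSpectrum.toPrimeSpectrum_continuous

theorem map_bot_of_isCompl (hinf : ∀ p q, e (p ⊓ q) = e p * e q)
    (hcompl : ∀ p q, IsCompl p q → e p + e q = 1) : e ⊥ = 0 := by
  have h1 := hcompl ⊥ ⊤ isCompl_bot_top
  have h2 := hinf ⊥ ⊤
  have h3 := hinf ⊥ ⊥
  rw [bot_inf_eq] at h2 h3
  -- Multiplying `e ⊥ + e ⊤ = 1` by `e ⊥` gives `2 e ⊥ = e ⊥`.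
  linear_combination h2 + h3 + e ⊥ * h1

/-- If `p ∈ I` were outside `J`, some maximal ideal would contain every `e q`, `q ∈ J`, but not `e
p`, and so separate the two open sets. -/
theorem le_of_opensOfIdeal_le [ComplementedLattice P] (hinf : ∀ p q, e (p ⊓ q) = e p * e q)
    (hcompl : ∀ p q, IsCompl p q → e p + e q = 1) (hzero : ∀ p, e p = 0 → p = ⊥)
    {I J : Order.Ideal P} (h : opensOfIdeal e I ≤ opensOfIdeal e J) : I ≤ J := by
  have hbot := map_bot_of_isCompl hinf hcompl
  have hmul : ∀ p q, IsCompl p q → e p * e q = 0 := fun p q hpq => by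
    rw [← hinf, hpq.inf_eq_bot, hbot]
  intro p hp
  by_contra hpJ
  -- the elements killed by some `e p * e q'` with `q'` complementary to a member of `J`
  let N : Ideal A :=
    { carrier := {a | ∃ q ∈ J, ∃ q', IsCompl q q' ∧ a * (e q' * e p) = 0}
      zero_mem' := ⟨⊥, J.bot_mem, ⊤, isCompl_bot_top, by simp⟩
      add_mem' := by
        rintro a b ⟨q, hq, q', hqq', ha⟩ ⟨r, hr, r', hrr', hb⟩
        refine ⟨q ⊔ r, Order.Ideal.sup_mem hq hr, q' ⊓ r', hqq'.sup_inf hrr', ?_⟩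
        rw [hinf]
        linear_combination e r' * ha + e q' * hb
      smul_mem' := by
        rintro c a ⟨q, hq, q', hqq', ha⟩
        refine ⟨q, hq, q', hqq', ?_⟩
        rw [smul_eq_mul]
        linear_combination c * ha }
  -- `1 ∈ N` would mean `e (q' ⊓ p) = 0`, so `p` is disjoint from `q'` and lies below `q ∈ J`.
  have hN : N ≠ ⊤ := by
    rw [Ideal.ne_top_iff_one]
    rintro ⟨q, hq, q', hqq', h1⟩
    rw [one_mul, ← hinf] at h1
    have hpq' : Disjoint p q' := (disjoint_iff.2 (hzero _ h1)).symm
    exact hpJ (J.lower (hpq'.le_of_codisjoint hqq'.symm.codisjoint) hq)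
  obtain ⟨m, hm, hNm⟩ := Ideal.exists_le_maximal N hN
  obtain ⟨p', hpp'⟩ := exists_isCompl p
  have hp'm : e p' ∈ m := hNm ⟨⊥, J.bot_mem, ⊤, isCompl_bot_top, by
    linear_combination e ⊤ * hmul p p' hpp'⟩
  have hpm : e p ∉ m := fun hpm =>
    hm.ne_top ((Ideal.eq_top_iff_one m).2 (hcompl p p' hpp' ▸ m.add_mem hpm hp'm))
  obtain ⟨q, hq, hqm⟩ := h (show (⟨m, hm⟩ : MaximalSpectrum A) ∈ opensOfIdeal e I from ⟨p, hp, hpm⟩)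
  obtain ⟨q', hqq'⟩ := exists_isCompl q
  exact hqm (hNm ⟨q, hq, q', hqq', by linear_combination e p * hmul q q' hqq'⟩)

/-- The ideal is the largest possible one: all `p` whose basic open set lies in `U`. The exchange
property shows that these sets cover `U`. -/
theorem exists_opensOfIdeal_eq (hinf : ∀ p q, e (p ⊓ q) = e p * e q)
    (hcompl : ∀ p q, IsCompl p q → e p + e q = 1) [ComplementedLattice P]
    (hexch : ∀ a : A, ∃ p q, IsCompl p q ∧ a ∣ e p ∧ 1 - a ∣ e q)
    (U : Opens (MaximalSpectrum A)) : ∃ I : Order.Ideal P, opensOfIdeal e I = U := by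
  have hbot := map_bot_of_isCompl hinf hcompl
  have hmono : ∀ {p q}, p ≤ q → e p = e p * e q := fun {p q} h => by
    rw [← hinf, inf_eq_left.2 h]
  refine ⟨
    { carrier := {p | ∀ m : MaximalSpectrum A, e p ∉ m.asIdeal → m ∈ U}
      lower' := fun p q hqp hp m hq => hp m fun hpm => hq (by
        rw [hmono hqp]; exact m.asIdeal.mul_mem_left _ hpm)
      nonempty' := ⟨⊥, fun m hm => absurd (hbot ▸ m.asIdeal.zero_mem) hm⟩
      directed' := fun p hp q hq => ⟨p ⊔ q, fun m hm => by
        by_contra hmU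
        have hpm := not_imp_comm.1 (hp m) hmU
        have hqm := not_imp_comm.1 (hq m) hmU
        obtain ⟨p', hpp'⟩ := exists_isCompl p
        refine hm ?_
        -- Split along `e p + e p' = 1`; the second part lives below `q`.
        have h1 : e (p ⊔ q) = e (p ⊔ q) * e p + e ((p ⊔ q) ⊓ p') := by
          rw [hinf]; linear_combination (-e (p ⊔ q)) * hcompl p p' hpp'
        have h2 : (p ⊔ q) ⊓ p' ≤ q := by
          rw [inf_sup_right, hpp'.inf_eq_bot, bot_sup_eq]; exact inf_le_left
        rw [h1, hmono h2]
        exact m.asIdeal.add_mem (m.asIdeal.mul_mem_left _ hpm) (m.asIdeal.mul_mem_left _ hqm),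
        le_sup_left, le_sup_right⟩ }, le_antisymm ?_ ?_⟩
  · rintro m ⟨p, hp, hpm⟩
    exact hp m hpm
  · intro m hm
    obtain ⟨V, hV, hVU⟩ := isOpen_induced_iff.1 U.isOpen
    have hmV : m.toPrimeSpectrum ∈ V := by
      have : m ∈ (U : Set (MaximalSpectrum A)) := hm
      rwa [← hVU] at this
    obtain ⟨_, ⟨a, rfl⟩, ham, haV⟩ :=
      PrimeSpectrum.isTopologicalBasis_basic_opens.exists_subset_of_mem_open hmV hV
    obtain ⟨b, i, hi, hbi⟩ := m.isMaximal.exists_inv (show a ∉ m.asIdeal from ham)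
    -- Here `1 - b * a = i` lies in `m`, hence so does `e q`, and `e p` cannot. Divisibility of `e
    -- p` by `b * a` keeps its basic open set inside that of `a`.
    obtain ⟨p, q, hpq, ⟨s, hs⟩, t, ht⟩ := hexch (b * a)
    have hqm : e q ∈ m.asIdeal := by
      rw [ht, ← hbi, add_sub_cancel_left]
      exact m.asIdeal.mul_mem_right _ hi
    refine ⟨p, fun n hn => ?_, fun hpm => m.isMaximal.ne_top
      ((Ideal.eq_top_iff_one _).2 (hcompl p q hpq ▸ m.asIdeal.add_mem hpm hqm))⟩
    have hnV : n.toPrimeSpectrum ∈ V := haV (show a ∉ n.asIdeal from fun han => hn (by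
      rw [hs]; exact n.asIdeal.mul_mem_right _ (n.asIdeal.mul_mem_left _ han)))
    have : n ∈ MaximalSpectrum.toPrimeSpectrum ⁻¹' V := hnV
    rwa [hVU] at this

/-- If for every `a` one of the idempotents `e p` is divisible by `a` and its complement by `1 - a`,
then the open sets of the maximal spectrum are the ideals of the lattice of these idempotents. -/
theorem nonempty_orderIso_opens_maximalSpectrum [ComplementedLattice P]
    (hinf : ∀ p q, e (p ⊓ q) = e p * e q)
    (hcompl : ∀ p q, IsCompl p q → e p + e q = 1) (hzero : ∀ p, e p = 0 → p = ⊥)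
    (hexch : ∀ a : A, ∃ p q, IsCompl p q ∧ a ∣ e p ∧ 1 - a ∣ e q) :
    Nonempty (Order.Ideal P ≃o Opens (MaximalSpectrum A)) :=
  ⟨RelIso.ofSurjective
    (OrderEmbedding.ofMapLEIff (opensOfIdeal e) fun _ _ =>
      ⟨le_of_opensOfIdeal_le hinf hcompl hzero, fun h _ ⟨p, hp, hm⟩ => ⟨p, h hp, hm⟩⟩)
    (exists_opensOfIdeal_eq hinf hcompl hexch)⟩

end Exchange

universe u

/-! ### Real functions on a frame: rays and lifted identities. -/

namespace R

variable {L : Type u} [Order.Frame L]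

/-- The open ray `(-∞, r)`. -/
def below (r : ℝ) : Opens ℝ := ⟨Set.Iio r, isOpen_Iio⟩

/-- The open ray `(r, ∞)`. -/
def above (r : ℝ) : Opens ℝ := ⟨Set.Ioi r, isOpen_Ioi⟩

theorem lift_sub {Z : Type} [TopologicalSpace Z] (η : FrameHom (Opens Z) L) (f g : C(Z, ℝ)) :
    lift η (f - g) = lift η f - lift η g := by
  rw [sub_eq_add_neg, sub_eq_add_neg, lift_add, lift_neg]

/-- Meeting with an open set sent to `⊤` changes no value of `η`, so an identity between functions
need only hold on such a set. -/
theorem lift_congr {Z : Type} [TopologicalSpace Z] (η : FrameHom (Opens Z) L) {f g : C(Z, ℝ)}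
    {W : Opens Z} (hW : η W = ⊤) (hfg : ∀ z ∈ W, f z = g z) : lift η f = lift η g := by
  refine DFunLike.ext (F := FrameHom (Opens ℝ) L) _ _ fun U => ?_
  change η (Opens.comap f U) = η (Opens.comap g U)
  have h : Opens.comap f U ⊓ W = Opens.comap g U ⊓ W := by
    ext z
    simp only [Opens.coe_inf, Opens.coe_comap, Set.mem_inter_iff, Set.mem_preimage]
    exact and_congr_left fun hz => by rw [hfg z hz]
  rw [← inf_top_eq (η (Opens.comap f U)), ← inf_top_eq (η (Opens.comap g U)), ← hW, ← map_inf,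
    ← map_inf, h]

/-- An element of `R L` as a frame homomorphism. -/
def toFrameHom (α : R L) : FrameHom (Opens ℝ) L := α

theorem toFrameHom_apply (α : R L) (U : Opens ℝ) : α.toFrameHom U = α U := rfl

theorem lift_id (α : R L) : lift α.toFrameHom (ContinuousMap.id ℝ) = α :=
  DFunLike.ext (F := FrameHom (Opens ℝ) L) _ _ fun _ => rfl

theorem coz_sub_const (α : R L) (r : ℝ) : coz (α - const r) = α (below r) ⊔ α (above r) := by
  have h : α - const r = lift α.toFrameHom (ContinuousMap.id ℝ - ContinuousMap.const ℝ r) := by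
    rw [lift_sub, lift_id, lift_const]
  rw [h]
  refine congrArg₂ (· ⊔ ·) (congrArg α ?_) (congrArg α ?_)
  · ext x; exact sub_neg (a := x) (b := r)
  · ext x; exact sub_pos (a := x) (b := r)

theorem notMem_pointfreeImage {α : R L} {r : ℝ} :
    r ∉ pointfreeImage α ↔ α (below r) ⊔ α (above r) = ⊤ := by
  rw [← coz_sub_const]; exact not_not

/-! ### Characteristic functions of complemented elements -/

/-- The homomorphism out of the discrete two-point space given by a pair of complements. -/
def boolHom {a b : L} (h : IsCompl a b) : FrameHom (Opens Bool) L where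
  toFun U := (⨆ _ : true ∈ U, a) ⊔ ⨆ _ : false ∈ U, b
  map_top' := by simpa using h.sup_eq_top
  map_inf' U V := by
    change (⨆ _ : true ∈ U ∧ true ∈ V, a) ⊔ (⨆ _ : false ∈ U ∧ false ∈ V, b) = _
    have := h.inf_eq_bot
    have := h.symm.inf_eq_bot
    by_cases h1 : true ∈ U <;> by_cases h2 : true ∈ V <;> by_cases h3 : false ∈ U <;>
      by_cases h4 : false ∈ V <;> simp [*]
  map_sSup' S := by
    refine le_antisymm (sup_le (iSup_le fun hS => ?_) (iSup_le fun hS => ?_))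
      (sSup_le ?_)
    · obtain ⟨U, hU, hx⟩ := Opens.mem_sSup.1 hS
      exact le_sSup_of_le ⟨U, hU, rfl⟩ (le_sup_of_le_left (le_iSup_of_le hx le_rfl))
    · obtain ⟨U, hU, hx⟩ := Opens.mem_sSup.1 hS
      exact le_sSup_of_le ⟨U, hU, rfl⟩ (le_sup_of_le_right (le_iSup_of_le hx le_rfl))
    · rintro _ ⟨U, hU, rfl⟩
      exact sup_le_sup
        (iSup_le fun hx => le_iSup_of_le (Opens.mem_sSup.2 ⟨U, hU, hx⟩) le_rfl)
        (iSup_le fun hx => le_iSup_of_le (Opens.mem_sSup.2 ⟨U, hU, hx⟩) le_rfl)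

/-- A point of the discrete two-point space as an open set. -/
def boolPoint (x : Bool) : Opens Bool := ⟨{x}, isOpen_discrete _⟩

theorem boolHom_true {a b : L} (h : IsCompl a b) : boolHom h (boolPoint true) = a := by
  change (⨆ _ : true ∈ ({true} : Set Bool), a) ⊔ (⨆ _ : false ∈ ({true} : Set Bool), b) = a
  simp

theorem boolHom_false {a b : L} (h : IsCompl a b) : boolHom h (boolPoint false) = b := by
  change (⨆ _ : true ∈ ({false} : Set Bool), a) ⊔ (⨆ _ : false ∈ ({false} : Set Bool), b) = b
  simp

theorem boolHom_unique {a b : L} (h : IsCompl a b) (η : FrameHom (Opens Bool) L)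
    (ha : η (boolPoint true) = a) (hb : η (boolPoint false) = b) : η = boolHom h := by
  ext U
  have hU : U = (⨆ _ : true ∈ U, boolPoint true) ⊔ ⨆ _ : false ∈ U, boolPoint false := by
    ext x
    cases x <;> simp [boolPoint]
  rw [hU]
  simp only [map_sup, map_iSup, ha, hb, boolHom_true, boolHom_false]

/-- The function with values `1` at `true` and `0` at `false`. -/
def boolVal : C(Bool, ℝ) := ⟨fun x => if x then 1 else 0, continuous_of_discreteTopology⟩

/-- The characteristic function of `a`, where `b` is the complement of `a`. -/
def char {a b : L} (h : IsCompl a b) : R L := lift (boolHom h) boolVal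

theorem char_above {a b : L} (h : IsCompl a b) : char h (above 0) = a := by
  refine Eq.trans (congrArg (boolHom h) ?_) (boolHom_true h)
  ext x
  cases x <;> simp [boolVal, boolPoint, above]

theorem eq_bot_of_char_eq_zero {a b : L} (h : IsCompl a b) (h0 : char h = 0) : a = ⊥ := by
  rw [← char_above h, h0]
  change (⨆ _ : (0 : ℝ) ∈ Set.Ioi (0 : ℝ), (⊤ : L)) = ⊥
  simp

theorem char_add_char {a b : L} (h : IsCompl a b) : char h + char h.symm = 1 := by
  let k : C(Bool, Bool) := ⟨not, continuous_of_discreteTopology⟩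
  have hk : (boolHom h).comp (Opens.comap k) = boolHom h.symm := by
    refine boolHom_unique h.symm _ ?_ ?_
    · refine Eq.trans (congrArg (boolHom h) ?_) (boolHom_false h)
      ext x; cases x <;> simp [k, boolPoint]
    · refine Eq.trans (congrArg (boolHom h) ?_) (boolHom_true h)
      ext x; cases x <;> simp [k, boolPoint]
  have h2 : char h.symm = lift (boolHom h) (boolVal.comp k) := by
    rw [char, ← hk]; rfl
  rw [h2, char, ← lift_add, ← lift_one (boolHom h)]
  congr 1
  ext x
  cases x <;> simp [boolVal, k]

/-- The Boolean "and" pulls `true` back to the meet `a ⊓ c` and `false` to the join `b ⊔ d`. Stating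
`x = a ⊓ c` as an equation allows the complement pair to be chosen independently. -/
theorem char_mul_char {a b c d x y : L} (h : IsCompl a b) (h' : IsCompl c d) (hxy : IsCompl x y)
    (hx : x = a ⊓ c) : char hxy = char h * char h' := by
  let k : C(Bool × Bool, Bool) := ⟨fun p => p.1 && p.2, continuous_of_discreteTopology⟩
  set η := pair (boolHom h) (boolHom h')
  have h1 : η.comp (Opens.comap ContinuousMap.fst) = boolHom h := pair_comap_fst _ _
  have h2 : η.comp (Opens.comap ContinuousMap.snd) = boolHom h' := pair_comap_snd _ _
  have hac : η (Opens.comap k (boolPoint true)) = a ⊓ c := by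
    rw [← boolHom_true h, ← boolHom_true h', ← h1, ← h2]
    simp only [FrameHom.comp_apply]
    rw [← map_inf]
    congr 1
    ext ⟨i, j⟩
    cases i <;> cases j <;> simp [k, boolPoint]
  have hbd : η (Opens.comap k (boolPoint false)) = b ⊔ d := by
    rw [← boolHom_false h, ← boolHom_false h', ← h1, ← h2]
    simp only [FrameHom.comp_apply]
    rw [← map_sup]
    congr 1
    ext ⟨i, j⟩
    cases i <;> cases j <;> simp [k, boolPoint]
  have hk : η.comp (Opens.comap k) = boolHom hxy := by
    refine boolHom_unique hxy _ (hac.trans hx.symm) (hbd.trans ?_)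
    subst hx
    exact (h.inf_sup h').right_unique hxy
  have e1 : char h = lift η (boolVal.comp ContinuousMap.fst) := by
    rw [char, ← h1]; rfl
  have e2 : char h' = lift η (boolVal.comp ContinuousMap.snd) := by
    rw [char, ← h2]; rfl
  have e3 : char hxy = lift η (boolVal.comp k) := by
    rw [char, ← hk]; rfl
  rw [e1, e2, e3, ← lift_mul]
  refine congrArg (lift η) ?_
  ext ⟨i, j⟩
  cases i <;> cases j <;> simp [k, boolVal]

/-- The function `1 / max x (1/3)`. -/
noncomputable def truncInv : C(ℝ, ℝ) where
  toFun x := (max x (1 / 3))⁻¹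
  continuous_toFun := (continuous_id.max continuous_const).inv₀ fun x =>
    (lt_of_lt_of_le (by norm_num) (le_max_right x (1 / 3))).ne'

/-- Where the characteristic function is nonzero, `α` exceeds `1/3`, so the cut-off inverse is the
true inverse there. -/
theorem char_eq_mul {a b : L} (h : IsCompl a b) {α : R L} (ha : a ≤ α (above (1 / 3))) :
    char h = α * (char h * op₁ truncInv α) := by
  set η := pair (boolHom h) α.toFrameHom
  have h1 : η.comp (Opens.comap ContinuousMap.fst) = boolHom h := pair_comap_fst _ _
  have h2 : η.comp (Opens.comap ContinuousMap.snd) = α.toFrameHom := pair_comap_snd _ _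
  have e1 : char h = lift η (boolVal.comp ContinuousMap.fst) := by
    rw [char, ← h1]; rfl
  have e2 : α = lift η ContinuousMap.snd := h2.symm
  have e3 : op₁ truncInv α = lift η (truncInv.comp ContinuousMap.snd) := by
    rw [e2]; rfl
  rw [e3, e1]
  conv_rhs => rw [e2]
  rw [← lift_mul, ← lift_mul]
  -- This set is sent to `(a ⊓ α (above (1/3))) ⊔ b = a ⊔ b = ⊤`.
  refine lift_congr η (W := (Opens.comap ContinuousMap.fst (boolPoint true) ⊓
    Opens.comap ContinuousMap.snd (above (1 / 3))) ⊔
      Opens.comap ContinuousMap.fst (boolPoint false)) ?_ ?_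
  · rw [map_sup, map_inf]
    simp only [← FrameHom.comp_apply, h1, h2, boolHom_true, boolHom_false, toFrameHom_apply]
    rw [inf_eq_left.2 ha, h.sup_eq_top]
  · rintro ⟨i, x⟩ hx
    cases i
    · simp [boolVal]
    · have hx' : (1 / 3 : ℝ) < x := by
        rcases hx with hx | hx
        · exact hx.2
        · simp [boolPoint] at hx
      have h0 : x ≠ 0 := by linarith
      simp [boolVal, truncInv, max_eq_left (by simpa using hx'.le : (3 : ℝ)⁻¹ ≤ x), h0]

theorem one_sub_above (α : R L) : (1 - α : R L) (above (1 / 3)) = α (below (2 / 3)) := by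
  have h : 1 - α = lift α.toFrameHom (1 - ContinuousMap.id ℝ) := by
    rw [lift_sub, lift_id, lift_one]
  rw [h]
  refine congrArg α ?_
  ext x
  change 1 / 3 < 1 - x ↔ x < 2 / 3
  constructor <;> intro h <;> linarith

/-- The open sets of the maximal spectrum of a ring of real functions on a frame in which the
members of a lattice `P` of complemented elements separate `{x ≤ 1/3}` from `{x ≥ 2/3}`. -/
theorem nonempty_orderIso_of_separated {A P : Type*} [CommRing A] [DistribLattice P]
    [BoundedOrder P] [ComplementedLattice P] (j : BoundedLatticeHom P L)
    (hj : ∀ p, j p = ⊥ → p = ⊥) (ι : A →+* R L) (hι : Function.Injective ι)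
    (hchar : ∀ (a b : L) (h : IsCompl a b), char h ∈ ι.range)
    (htrunc : ∀ a, op₁ truncInv (ι a) ∈ ι.range)
    (hsep : ∀ a, ∃ p q, IsCompl p q ∧ j p ≤ ι a (above (1 / 3)) ∧ j q ≤ ι a (below (2 / 3))) :
    Nonempty (Order.Ideal P ≃o Opens (MaximalSpectrum A)) := by
  have hjc : ∀ {p q}, IsCompl p q → IsCompl (j p) (j q) := fun {p q} h => h.map j
  choose c hc using fun p : P => exists_isCompl p
  choose e he using fun p : P => hchar _ _ (hjc (hc p))
  -- Uniqueness of complements frees `e p` from the chosen `c p`.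
  have he' : ∀ p q (h : IsCompl p q), ι (e p) = char (hjc h) := fun p q h => by
    obtain rfl : c p = q := (hc p).right_unique h
    exact he p
  refine nonempty_orderIso_opens_maximalSpectrum (e := e) (fun p q => hι ?_)
    (fun p q h => hι ?_) (fun p hp => hj p ?_) fun a => ?_
  · rw [map_mul, he, he, he]
    exact char_mul_char _ _ _ (map_inf j p q)
  · rw [map_add, map_one, he' p q h, he' q p h.symm]
    exact char_add_char _
  · exact eq_bot_of_char_eq_zero (hjc (hc p)) (by rw [← map_zero ι, ← hp]; exact (he p).symm)
  · obtain ⟨p, q, hpq, hp, hq⟩ := hsep a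
    obtain ⟨b, hb⟩ := htrunc a
    obtain ⟨b', hb'⟩ := htrunc (1 - a)
    refine ⟨p, q, hpq, ⟨e p * b, hι ?_⟩, ⟨e q * b', hι ?_⟩⟩
    · rw [map_mul, map_mul, he' p q hpq, hb]
      exact char_eq_mul _ hp
    · rw [map_mul, map_mul, he' q p hpq.symm, hb', map_sub, map_one]
      exact char_eq_mul _ (hq.trans (one_sub_above _).ge)

/-! ### Functions with countable pointfree image. -/

section CountableImage

variable {L : Type u} [Order.Frame L]

theorem pointfreeImage_char_subset {a b : L} (h : IsCompl a b) :
    pointfreeImage (char h) ⊆ {0, 1} := by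
  intro r hr
  contrapose! hr
  simp only [Set.mem_insert_iff, Set.mem_singleton_iff, not_or] at hr
  rw [notMem_pointfreeImage]
  change boolHom h (Opens.comap boolVal (below r)) ⊔ boolHom h (Opens.comap boolVal (above r)) = ⊤
  rw [← map_sup, ← map_top (boolHom h)]
  congr 1
  ext x
  cases x
  · simpa [boolVal, below, above] using (Ne.symm hr.1).lt_or_gt
  · simpa [boolVal, below, above] using (Ne.symm hr.2).lt_or_gt

/-- The extra value `3` is taken where the cut-off at `1/3` is active. -/
theorem pointfreeImage_truncInv_subset (α : R L) :
    pointfreeImage (op₁ truncInv α) ⊆ insert 3 ((fun x => x⁻¹) '' pointfreeImage α) := by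
  intro r hr
  contrapose! hr
  rw [Set.mem_insert_iff, not_or] at hr
  have hα : r⁻¹ ∉ pointfreeImage α := fun h => hr.2 ⟨_, h, inv_inv r⟩
  rw [notMem_pointfreeImage] at hα ⊢
  change α (Opens.comap truncInv (below r)) ⊔ α (Opens.comap truncInv (above r)) = ⊤
  rw [← map_sup, ← top_le_iff] at hα ⊢
  refine hα.trans (OrderHomClass.mono α fun x hx => ?_)
  have hx' : x ≠ r⁻¹ := by
    rcases hx with hx | hx
    · exact ne_of_lt hx
    · exact ne_of_gt hx
  have hne : (max x (1 / 3))⁻¹ ≠ r := by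
    rintro rfl
    rcases max_choice x (1 / 3) with h | h
    · exact hx' (by rw [h, inv_inv])
    · exact hr.1 (by rw [h]; norm_num)
  exact hne.lt_or_gt

/-- The ideals of complemented elements are the open sets of the maximal spectrum of `R_c L`. -/
theorem IsRc.nonempty_orderIso {S : Subring (R L)} (hS : IsRc S) :
    Nonempty (BetaZero L ≃o Opens (MaximalSpectrum S)) := by
  have hchar : ∀ (a b : L) (h : IsCompl a b), char h ∈ S.subtype.range := fun a b h => by
    rw [Subring.range_subtype, hS]
    exact (Set.toFinite {0, 1}).countable.mono (pointfreeImage_char_subset h)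
  refine nonempty_orderIso_of_separated (L := L) (P := Complementeds L)
    { toFun := Subtype.val
      map_sup' := fun _ _ => rfl
      map_inf' := fun _ _ => rfl
      map_top' := rfl
      map_bot' := rfl } (fun p hp => Subtype.ext hp) S.subtype Subtype.val_injective hchar
    (fun a => ?_) fun a => ?_
  · rw [Subring.range_subtype, hS]
    exact ((((hS a).1 a.2).image _).insert 3).mono (pointfreeImage_truncInv_subset _)
  · obtain ⟨r, hr, hr1, hr2⟩ := ((hS a).1 a.2).dense_compl ℝ |>.exists_between
      (show (1 / 3 : ℝ) < 2 / 3 by norm_num)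
    have hc : IsCompl ((a : R L) (above r)) ((a : R L) (below r)) := by
      refine (IsCompl.of_eq ?_ (notMem_pointfreeImage.1 hr)).symm
      rw [← map_inf, ← map_bot (a : R L)]
      congr 1
      ext x
      simpa [below, above] using fun h : x < r => h.le
    refine ⟨⟨_, _, hc⟩, ⟨_, _, hc.symm⟩, ?_, OrderHomClass.mono (a : R L) ?_,
      OrderHomClass.mono (a : R L) ?_⟩
    · refine IsCompl.of_eq (Subtype.ext hc.inf_eq_bot) (Subtype.ext hc.sup_eq_top)
    · exact fun x hx => hr1.trans hx
    · exact fun x hx => lt_trans (show x < r from hx) hr2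

end CountableImage

/-! ### Frames of ideals: compactness, and prime ideals as points. -/

section Ideals

variable {P : Type u} [DistribLattice P] [BoundedOrder P]

/-- Principal ideals, as a homomorphism of bounded lattices. -/
def principalHom : BoundedLatticeHom P (Order.Ideal P) where
  toFun := Order.Ideal.principal
  map_sup' p q := le_antisymm
    (Order.Ideal.principal_le_iff.2 (Order.Ideal.sup_mem
      ((le_sup_left : Order.Ideal.principal p ≤ _) Order.Ideal.mem_principal_self)
      ((le_sup_right : Order.Ideal.principal q ≤ _) Order.Ideal.mem_principal_self)))
    (sup_le (Order.Ideal.principal_le_iff.2 (Order.Ideal.mem_principal.2 le_sup_left))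
      (Order.Ideal.principal_le_iff.2 (Order.Ideal.mem_principal.2 le_sup_right)))
  map_inf' p q := by
    ext x
    simp
  map_top' := Order.Ideal.principal_top
  map_bot' := Order.Ideal.principal_bot

theorem principalHom_le_iff {p : P} {I : Order.Ideal P} : principalHom p ≤ I ↔ p ∈ I :=
  Order.Ideal.principal_le_iff

/-- The two overlapping rays cover `ℝ`, so `⊤` already lies below `i ⊔ k` with one member from each
ideal; the complement of `i` is then below `k`. -/
theorem exists_principal_separated [ComplementedLattice P] (α : R (Order.Ideal P)) :
    ∃ p q, IsCompl p q ∧ principalHom p ≤ α (above (1 / 3)) ∧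
      principalHom q ≤ α (below (2 / 3)) := by
  have h : α (above (1 / 3)) ⊔ α (below (2 / 3)) = ⊤ := by
    rw [← map_sup, ← map_top α]
    congr 1
    refine top_le_iff.1 fun x _ => ?_
    exact (lt_or_ge (1 / 3) x).imp id fun hx => lt_of_le_of_lt hx (by norm_num)
  have ht : (⊤ : P) ∈ α (above (1 / 3)) ⊔ α (below (2 / 3)) := h ▸ trivial
  obtain ⟨i, hi, k, hk, hik⟩ := Order.Ideal.mem_sup.1 ht
  obtain ⟨i', hii'⟩ := exists_isCompl i
  refine ⟨i, i', hii', principalHom_le_iff.2 hi, principalHom_le_iff.2 (Order.Ideal.lower _ ?_ hk)⟩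
  exact hii'.symm.disjoint.le_of_codisjoint (codisjoint_iff_le_sup.2 hik)

/-- Separation is by principal ideals, so the idempotents can be indexed by `P` itself, without
determining all complemented elements of the frame of ideals. -/
theorem nonempty_orderIso_ideal [ComplementedLattice P] {A : Type*} [CommRing A]
    (ι : A →+* R (Order.Ideal P)) (hι : Function.Injective ι)
    (hchar : ∀ (a b : Order.Ideal P) (h : IsCompl a b), char h ∈ ι.range)
    (htrunc : ∀ a, op₁ truncInv (ι a) ∈ ι.range) :
    Nonempty (Order.Ideal P ≃o Opens (MaximalSpectrum A)) :=
  nonempty_orderIso_of_separated principalHom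
    (fun _ hp => le_bot_iff.1 (principalHom_le_iff.1 hp.le)) ι hι hchar htrunc
    fun a => exists_principal_separated (ι a)

/-- The real function `α` takes the value `x` at the point given by the prime ideal `I`. -/
def HasValue (I : Order.Ideal P) (α : R (Order.Ideal P)) (x : ℝ) : Prop :=
  ∀ U : Opens ℝ, x ∈ U ↔ ¬ α U ≤ I

theorem not_inf_le_of_isPrime {I J K : Order.Ideal P} (hI : I.IsPrime) (hJ : ¬ J ≤ I)
    (hK : ¬ K ≤ I) : ¬ J ⊓ K ≤ I := by
  obtain ⟨x, hxJ, hx⟩ := Set.not_subset.1 hJ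
  obtain ⟨y, hyK, hy⟩ := Set.not_subset.1 hK
  intro h
  exact (hI.mem_or_mem (h (show x ⊓ y ∈ J ⊓ K from
    ⟨J.lower inf_le_left hxJ, K.lower inf_le_right hyK⟩))).elim hx hy

/-- The largest open set sent below `I` is proper and, by primeness, contains one of any two
disjoint open sets. As `ℝ` is Hausdorff, its complement is a single point, the value. -/
theorem exists_hasValue {I : Order.Ideal P} (hI : I.IsPrime) (α : R (Order.Ideal P)) :
    ∃ x, HasValue I α x := by
  set V : Opens ℝ := sSup {U | α U ≤ I} with hV
  have hVI : α V ≤ I := by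
    rw [hV, map_sSup]
    refine sSup_le ?_
    rintro _ ⟨U, hU, rfl⟩
    exact hU
  have hle : ∀ U, α U ≤ I ↔ U ≤ V := fun U =>
    ⟨fun h => le_sSup h, fun h => (OrderHomClass.mono α h).trans hVI⟩
  obtain ⟨x, hx⟩ : ∃ x, x ∉ V := by
    by_contra hne
    have h : ∀ x, x ∈ V := fun x => not_not.1 fun hx => hne ⟨x, hx⟩
    refine hI.toIsProper.ne_top (top_le_iff.1 ?_)
    rw [← map_top α, hle]
    exact fun x _ => h x
  refine ⟨x, fun U => ⟨fun hxU hU => hx ((hle U).1 hU hxU), fun hU => ?_⟩⟩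
  by_contra hxU
  rw [hle] at hU
  obtain ⟨y, hyU, hyV⟩ := Set.not_subset.1 hU
  have hxy : x ≠ y := fun h => hxU (h ▸ hyU)
  obtain ⟨A, B, hA, hB, hxA, hyB, hAB⟩ := t2_separation hxy
  refine not_inf_le_of_isPrime hI (J := α ⟨A, hA⟩) (K := α ⟨B, hB⟩)
    (fun h => hx ((hle _).1 h hxA)) (fun h => hyV ((hle _).1 h hyB)) ?_
  rw [← map_inf]
  have : (⟨A, hA⟩ ⊓ ⟨B, hB⟩ : Opens ℝ) = ⊥ := Opens.ext (Set.disjoint_iff_inter_eq_empty.1 hAB)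
  rw [this, map_bot]
  exact bot_le

/-- If the rays at `r` do not join to `⊤`, a prime ideal contains both of their images, and the
value there can be neither less nor greater than `r`. -/
theorem mem_pointfreeImage_iff {α : R (Order.Ideal P)} {r : ℝ} :
    r ∈ pointfreeImage α ↔ ∃ I : Order.Ideal P, I.IsPrime ∧ HasValue I α r := by
  constructor
  · intro hr
    have hne : α (below r) ⊔ α (above r) ≠ ⊤ := fun h => notMem_pointfreeImage.2 h hr
    obtain ⟨I, hI, hle, -⟩ := DistribLattice.prime_ideal_of_disjoint_filter_ideal
      -- Being disjoint from the filter `{⊤}` is the same as being proper.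
      (F := Order.PFilter.principal (⊤ : P)) (I := α (below r) ⊔ α (above r)) (by
        rw [Set.disjoint_left]
        intro x hx hxI
        rw [SetLike.mem_coe, Order.PFilter.mem_principal, top_le_iff] at hx
        subst hx
        exact hne (Order.Ideal.top_mem_iff_eq_top.1 hxI))
    obtain ⟨x, hx⟩ := exists_hasValue hI α
    have h1 : ¬ x < r := fun h => (hx (below r)).1 h (le_sup_left.trans hle)
    have h2 : ¬ r < x := fun h => (hx (above r)).1 h (le_sup_right.trans hle)
    obtain rfl : x = r := le_antisymm (not_lt.1 h2) (not_lt.1 h1)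
    exact ⟨I, hI, hx⟩
  · rintro ⟨I, hI, hr⟩
    by_contra h
    rw [notMem_pointfreeImage] at h
    refine hI.toIsProper.ne_top (top_le_iff.1 (h ▸ sup_le ?_ ?_))
    · by_contra hlt; exact lt_irrefl r ((hr (below r)).2 hlt)
    · by_contra hlt; exact lt_irrefl r ((hr (above r)).2 hlt)

theorem HasValue.unique {I : Order.Ideal P} {α : R (Order.Ideal P)} {x y : ℝ}
    (hx : HasValue I α x) (hy : ∀ U : Opens ℝ, y ∈ U → ¬ α U ≤ I) : x = y := by
  by_contra hne
  exact (hx ⟨{x}ᶜ, isOpen_compl_singleton⟩).2 (hy _ (Ne.symm hne)) rfl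

/-- At a prime ideal the value of `op₂ f α β` is `f` of the two values, since primeness keeps the
meet of two images that are not below `I` from being below `I`. -/
theorem pointfreeImage_op₂_subset (f : C(ℝ × ℝ, ℝ)) (α β : R (Order.Ideal P)) :
    pointfreeImage (op₂ f α β) ⊆
      Set.image2 (fun x y => f (x, y)) (pointfreeImage α) (pointfreeImage β) := by
  intro r hr
  obtain ⟨I, hI, hIr⟩ := mem_pointfreeImage_iff.1 hr
  obtain ⟨x, hx⟩ := exists_hasValue hI α
  obtain ⟨y, hy⟩ := exists_hasValue hI β
  refine ⟨x, mem_pointfreeImage_iff.2 ⟨I, hI, hx⟩, y, mem_pointfreeImage_iff.2 ⟨I, hI, hy⟩,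
    (hIr.unique fun U hU => ?_).symm⟩
  obtain ⟨A, B, hA, hB, hxA, hyB, hAB⟩ :=
    isOpen_prod_iff.1 (Opens.comap f U).isOpen x y hU
  intro hle
  refine not_inf_le_of_isPrime hI ((hx ⟨A, hA⟩).1 hxA) ((hy ⟨B, hB⟩).1 hyB) (le_trans ?_ hle)
  exact le_pairFun α β (V := ⟨A, hA⟩) (W := ⟨B, hB⟩) hAB

theorem pointfreeImage_const_subset {L : Type u} [Order.Frame L] (r : ℝ) :
    pointfreeImage (const r : R L) ⊆ {r} := by
  intro s hs
  contrapose! hs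
  rw [notMem_pointfreeImage]
  change (⨆ _ : r < s, (⊤ : L)) ⊔ (⨆ _ : s < r, (⊤ : L)) = ⊤
  rcases (Ne.symm hs).lt_or_gt with h | h <;> simp [h]

theorem pointfreeImage_neg_subset {L : Type u} [Order.Frame L] (α : R L) :
    pointfreeImage (-α) ⊆ (fun x => -x) '' pointfreeImage α := by
  intro r hr
  refine ⟨-r, ?_, neg_neg r⟩
  contrapose! hr
  rw [notMem_pointfreeImage] at hr ⊢
  rw [← hr, sup_comm]
  refine congrArg₂ (· ⊔ ·) (congrArg α ?_) (congrArg α ?_)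
  · ext x
    exact lt_neg (a := r) (b := x)
  · ext x
    exact neg_lt (a := x) (b := r)

/-- `R_c` of a frame of ideals. -/
def countableImageSubring (P : Type u) [DistribLattice P] [BoundedOrder P] :
    Subring (R (Order.Ideal P)) where
  carrier := {α | (pointfreeImage α).Countable}
  mul_mem' ha hb := (ha.image2 hb _).mono (pointfreeImage_op₂_subset _ _ _)
  one_mem' := (Set.countable_singleton _).mono (pointfreeImage_const_subset 1)
  add_mem' ha hb := (ha.image2 hb _).mono (pointfreeImage_op₂_subset _ _ _)
  zero_mem' := (Set.countable_singleton _).mono (pointfreeImage_const_subset 0)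
  neg_mem' ha := (ha.image _).mono (pointfreeImage_neg_subset _)

theorem isRc_countableImageSubring : IsRc (countableImageSubring P) := fun _ => Iff.rfl

end Ideals

end R

end PointfreeReal

theorem corollary8p4 {L : Type*} [Order.Frame L] (hL : PointfreeReal.IsZeroDimensional L) :
    (∀ S : Subring (PointfreeReal.R L), PointfreeReal.R.IsRc S →
      Nonempty (PointfreeReal.BetaZero L ≃o TopologicalSpace.Opens (MaximalSpectrum S))) ∧
    (∃ T : Subring (PointfreeReal.R (PointfreeReal.BetaZero L)), PointfreeReal.R.IsRc T ∧
      Nonempty (PointfreeReal.BetaZero L ≃o TopologicalSpace.Opens (MaximalSpectrum T))) ∧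
    Nonempty (PointfreeReal.BetaZero L ≃o
      TopologicalSpace.Opens
        (MaximalSpectrum (PointfreeReal.R (PointfreeReal.BetaZero L)))) := by
  refine ⟨fun S hS => hS.nonempty_orderIso,
    ⟨_, PointfreeReal.R.isRc_countableImageSubring, ?_⟩, ?_⟩
  · refine PointfreeReal.R.nonempty_orderIso_ideal
      (PointfreeReal.R.countableImageSubring _).subtype Subtype.val_injective
      (fun a b h => ?_) fun a => ?_
    · rw [Subring.range_subtype]
      exact (Set.toFinite {0, 1}).countable.mono (PointfreeReal.R.pointfreeImage_char_subset h)
    · rw [Subring.range_subtype]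
      exact ((a.2.image _).insert 3).mono (PointfreeReal.R.pointfreeImage_truncInv_subset _)
  · exact PointfreeReal.R.nonempty_orderIso_ideal (RingHom.id _) Function.injective_id
      (fun _ _ _ => ⟨_, rfl⟩) fun _ => ⟨_, rfl⟩
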